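/- **Conventions.** $G=(V,E)$ is a finite simple undirected unweighted graph, $n=|V|$, $\log=\log_2$. The subdivision graph $G'$ has vertex set $V\cup\{x_e : e\in E\}$ and edges $x_ev$ for $v\in e$; for $F\subseteq E$ let $X_F=\{x_e:e\in F\}$. For $S\subseteq V$ let $S'=S\cup\{x_e: e\cap S\neq\emptyset\}$. All edges of $G$ and $G'$ have capacity $1$. A demand state on a vertex set $U$ with a finite set $\mathcal K$ of commodities is $P\in\mathbb R^{U\times\mathcal K}$; its load at $v$ is $\|P(v)\|_1=\sum_k|P(v,k)|$; it is valid if $\sum_{v\in U}P(v,k)=0$ for every $k$; its demand across $(A,U\setminus A)$ is $\mathrm{dem}_P(A)=\sum_k\bigl|\sum_{v\in A}P(v,k)\bigr|$. A capacitated graph on $U$ $\gamma$-respects a valid $P$ if $\mathrm{cap}(A,U\setminus A)\ge\gamma\,\mathrm{dem}_P(A)$ for every $A\subseteq U$. A set $X$ of vertices $\varphi$-expands in a graph on $U$ if $\mathrm{cap}(A,U\setminus A)\ge\varphi\min(|X\cap A|,|X\setminus A|)$ for every $A\subseteq U$. A multi-commodity flow has congestion at most $\kappa$ if on every edge the total flow,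 over all commodities and in both directions, is at most $\kappa$ times the capacity of the edge. **Tree.** $T$ is a hierarchical decomposition tree of $V$, given by a laminar family of non-empty clusters with root $V$ and leaves $\{v\}$, $v\in V$. The edge between a cluster $C$ and its parent has capacity $\mathrm{cap}_G(C,V\setminus C)$. $P$ is a valid demand state on $V$ that is $1$-respected by $T$ (each $v$ being identified with the leaf $\{v\}$). **Invariant.** A demand state $Q$ on the vertices of $G'$ satisfies the invariant for a cluster $C$ with load $\alpha$ if (1) $Q(x,\cdot)=0$ for all $x\notin X_{E(C,V\setminus C)}$; (2) $\sum_{x\in C'}Q(x,k)=\sum_{v\in C}P(v,k)$ for all $k$; (3) $\|Q(x)\|_1\le\alpha$ for all $x\in C'$. **Merge phase.** Let $0<\tau\le1$, let $S$ be a cluster of $T$ and $B=E(S,V\setminus S)$. A *merge-phase partition* of $S$ with parameter $\tau$ and expansion constant $c_0>0$ consists of the following. * A partition of $S$ into non-empty sets $Z_1,\dots,Z_z$ with $G[Z_i]$ connected and $|Z_i|\le\frac23|S|$, such that, for the set $F$ of edges between different $Z_i$, the set $X_F$ $\frac{c_0}{\log n}$-expands in the subdivision graph $G[S]'$ of $G[S]$.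 * A set $Y$ of edges with an endpoint in $S$ such that every path in $G'[S']$ from $X_B$ to $X_F$ contains a node of $X_Y$ (possibly an end node), and such that, with $\mu_\tau(x_e)=\tau$ for $e\in B$ and $\mu_\tau(x_e)=1$ otherwise, there are two flows in $G'[S']$ routable with congestion $2$ in which every $x_y\in X_Y$ sends out exactly $\mu_\tau(x_y)$ units: one from $X_Y$ to $X_B$ in which every node of $X_B$ receives at most $2\tau$ units, and one from $X_Y$ to $X_F$ in which every node of $X_F$ receives at most $2$ units. * $R$ is the set of vertices of $S$ that can reach a node of $X_B\setminus X_Y$ in $G'[S']\setminus X_Y$, and $L=S\setminus R$. The sub-clusters $S_1,\dots,S_t$ of $S$ are the non-empty sets among $L\cap Z_i$ and $R\cap Z_i$. The non-empty ones of $L$, $R$, and all $S_1,\dots,S_t$ are clusters of $T$. **Theorem.** There is an absolute constant $c>0$, and for every $c_0>0$ there is a constant $c'>0$ depending only on $c_0$, such that the following holds for all $G,T,\mathcal K,P,\tau,S$ as above. Let $S_1,\dots,S_t$ be the sub-clusters of a merge-phase partition of $S$ with parameter $\tau$ and expansion constant $c_0$. Let $\alpha\ge1$, let $P_{S_i'}$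 satisfy the invariant for $S_i$ with load $\alpha$ for each $i$, and let $P^{\mathrm{before}}_{S'}=\sum_{i=1}^tP_{S_i'}$. Then there is a demand state $P^{\mathrm{after}}_{S'}$ such that 1. $P^{\mathrm{after}}_{S'}$ satisfies the invariant for $S$ with load $\alpha(1+c\tau)$; 2. $P^{\mathrm{before}}_{S'}-P^{\mathrm{after}}_{S'}$ is a valid demand state on $S'$, and $G'[S']$ $\frac{c'\tau}{\alpha\log n}$-respects it. -/

import Mathlib

open scoped Classical

noncomputable section

namespace MergePhase

variable {V W K : Type*}

/-! ### Capacities, cuts, demand states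

A (weighted, undirected) graph on a finite vertex set `W` enters only through its symmetric
capacity function `c : W → W → ℝ`, where `c a b = 0` means that there is no edge `ab`. -/

/-- Unit capacities on the edges of a simple graph. -/
def unitCap (H : SimpleGraph W) (a b : W) : ℝ :=
  if H.Adj a b then 1 else 0

/-- The capacity of the cut `(A, Aᶜ)`. -/
def cutCap [Fintype W] (c : W → W → ℝ) (A : Finset W) : ℝ :=
  ∑ a ∈ A, ∑ b ∈ Aᶜ, c a b

/-- A demand state `P` on `W` with commodities `K` is valid if no mass of any commodity is created
or destroyed in total. -/
def IsValid [Fintype W] (P : W → K → ℝ) : Prop :=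
  ∀ k, ∑ u, P u k = 0

/-- The demand of a (valid) demand state across the cut `(A, Aᶜ)`. -/
def dem [Fintype K] (P : W → K → ℝ) (A : Finset W) : ℝ :=
  ∑ k, |∑ u ∈ A, P u k|

/-- The load `‖P(v)‖₁` of a demand state on the vertex `v`. -/
def load [Fintype K] (P : W → K → ℝ) (v : W) : ℝ :=
  ∑ k, |P v k|

/-- The graph with capacities `c` `γ`-respects the (valid) demand state `P`: every cut has capacity
at least `γ` times the demand of `P` across it. -/
def Respects [Fintype W] [Fintype K] (c : W → W → ℝ) (γ : ℝ) (P : W → K → ℝ) : Prop :=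
  ∀ A : Finset W, γ * dem P A ≤ cutCap c A

/-- The vertex set `X` `φ`-expands in the graph with capacities `c`. -/
def Expands [Fintype W] (c : W → W → ℝ) (φ : ℝ) (X : Set W) : Prop :=
  ∀ A : Finset W,
    φ * min ((X ∩ (A : Set W)).ncard : ℝ) ((X \ (A : Set W)).ncard : ℝ) ≤ cutCap c A

/-! ### Multi-commodity flows -/

/-- The demand matrix `D` can be routed with congestion `κ`. Here `f s a b` is the amount of the
commodity with source `s` that is sent along the edge `ab` from `a` to `b`; `D s t` units of it
have to be delivered from `s` to `t`. The last condition bounds the total flow, of all commodities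
and in both directions, on the edge `ab`; it also forces the flow to vanish off the edges. -/
def Routable [Fintype W] (c : W → W → ℝ) (κ : ℝ) (D : W → W → ℝ) : Prop :=
  ∃ f : W → W → W → ℝ,
    (∀ s a b, 0 ≤ f s a b) ∧
    (∀ s v, ∑ b, f s v b - ∑ b, f s b v = (if v = s then ∑ t, D s t else 0) - D s v) ∧
    (∀ a b, ∑ s, (f s a b + f s b a) ≤ κ * c a b)

/-- There is a flow from `A` to `B`, routable with congestion `κ`, such that every `s ∈ A` sends
out exactly `out s` units and every `t ∈ B` receives at most `cap` units. -/
def FlowFromTo [Fintype W] (c : W → W → ℝ) (κ : ℝ) (A B : Set W) (out : W → ℝ) (cap : ℝ) : Prop :=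
  ∃ D : W → W → ℝ,
    (∀ s t, 0 ≤ D s t) ∧
    (∀ s t, D s t ≠ 0 → s ∈ A ∧ t ∈ B) ∧
    (∀ s ∈ A, ∑ t, D s t = out s) ∧
    (∀ t ∈ B, ∑ s, D s t ≤ cap) ∧
    Routable c κ D

/-! ### The subdivision graph -/

/-- Vertices of the subdivision graph `G'`: the vertices of `G` and a split vertex `x_e` for every
edge `e` of `G`. -/
inductive SubdivVertex (G : SimpleGraph V) : Type _
  | orig (v : V) : SubdivVertex G
  | split (e : G.edgeSet) : SubdivVertex G

instance (G : SimpleGraph V) [Finite V] : Finite (SubdivVertex G) :=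
  Finite.of_injective
    (fun x : SubdivVertex G => match x with
      | .orig v => (Sum.inl v : V ⊕ G.edgeSet)
      | .split e => Sum.inr e)
    (by rintro (v | e) (w | e') h <;> simp_all)

instance (G : SimpleGraph V) [Fintype V] : Fintype (SubdivVertex G) :=
  Fintype.ofFinite _

/-- The subdivision graph `G'`: `x_e` is adjacent to the two endpoints of `e`. -/
def subdivision (G : SimpleGraph V) : SimpleGraph (SubdivVertex G) where
  Adj x y := match x, y with
    | .orig v, .split e => v ∈ (e : Sym2 V)
    | .split e, .orig v => v ∈ (e : Sym2 V)
    | _, _ => False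
  symm := ⟨by rintro (v | e) (w | e') h <;> simp_all⟩
  loopless := ⟨by rintro (v | e) h <;> exact h⟩

/-- The set `X_F` of split vertices of a set `F` of edges. -/
def splitSet (G : SimpleGraph V) (F : Set (Sym2 V)) : Set (SubdivVertex G) :=
  {x | ∃ e : G.edgeSet, (e : Sym2 V) ∈ F ∧ x = .split e}

/-- `S'`: the vertices of `S` and the split vertices of all edges with at least one endpoint
in `S`. -/
def primed (G : SimpleGraph V) (S : Finset V) : Set (SubdivVertex G) :=
  {x | match x with
    | .orig v => v ∈ S
    | .split e => ∃ v ∈ (e : Sym2 V), v ∈ S}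

/-- The vertices of `G` in `S` and the split vertices of the edges with both endpoints in `S`. The
subgraph of `G'` induced by this set is the subdivision graph `G[S]'` of `G[S]`. -/
def innerPrimed (G : SimpleGraph V) (S : Finset V) : Set (SubdivVertex G) :=
  {x | match x with
    | .orig v => v ∈ S
    | .split e => ∀ v ∈ (e : Sym2 V), v ∈ S}

/-- The unit capacities of the subgraph `G'[U]` of the subdivision graph induced by `U`. -/
def subCap (G : SimpleGraph V) (U : Set (SubdivVertex G)) : U → U → ℝ :=
  unitCap ((subdivision G).induce U)

/-- The boundary edges `E(S, V ∖ S)` of `S`. -/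
def boundaryEdges (G : SimpleGraph V) (S : Finset V) : Set (Sym2 V) :=
  {e | e ∈ G.edgeSet ∧ ∃ u ∈ S, ∃ v ∉ S, e = s(u, v)}

/-- The edges between different parts of a partition `Z` of `S`. -/
def interClusterEdges (G : SimpleGraph V) {S : Finset V} (Z : Finpartition S) : Set (Sym2 V) :=
  {e | e ∈ G.edgeSet ∧ ∃ A ∈ Z.parts, ∃ B ∈ Z.parts, A ≠ B ∧ ∃ u ∈ A, ∃ v ∈ B, e = s(u, v)}

/-- `b` can be reached from `a` in `H[U]`. -/
def ReachableWithin (H : SimpleGraph W) (U : Set W) (a b : W) : Prop :=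
  ∃ p : H.Walk a b, ∀ y ∈ p.support, y ∈ U

/-! ### The merge phase -/

/-- The specification of the first partition `Z₁, …, Z_z` of the cluster `S`: the parts are
connected, contain at most two thirds of `S`, and the split vertices of the inter-cluster edges
`(c₀ / log₂ n)`-expand in `G[S]'`, where `n = |V|`. -/
structure IsFirstPartition [Fintype V] (G : SimpleGraph V) (c₀ : ℝ) {S : Finset V}
    (Z : Finpartition S) : Prop where
  connected : ∀ A ∈ Z.parts, (G.induce (A : Set V)).Connected
  card_le : ∀ A ∈ Z.parts, (A.card : ℝ) ≤ 2 / 3 * S.card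
  expands : Expands (subCap G (innerPrimed G S)) (c₀ / Real.logb 2 (Fintype.card V))
    {x | (x : SubdivVertex G) ∈ splitSet G (interClusterEdges G Z)}

/-- The weighting `μ_τ`: split vertices of boundary edges of `S` have weight `τ`, all other
vertices have weight `1`. -/
def weight (G : SimpleGraph V) (τ : ℝ) (S : Finset V) (x : SubdivVertex G) : ℝ :=
  if x ∈ splitSet G (boundaryEdges G S) then τ else 1

/-- The specification of the set `Y` of cut edges that separates the inter-cluster edges `F` of the
first partition from the boundary edges `B` of `S`. -/
structure IsBottleneckCut [Fintype V] (G : SimpleGraph V) (τ : ℝ) {S : Finset V}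
    (Z : Finpartition S) (Y : Set (Sym2 V)) : Prop where
  /-- `X_Y` is a set of split vertices of `G'[S']` -/
  subset : ∀ e ∈ Y, e ∈ G.edgeSet ∧ ∃ v ∈ e, v ∈ S
  flow_boundary : FlowFromTo (subCap G (primed G S)) 2
    {x | (x : SubdivVertex G) ∈ splitSet G Y}
    {x | (x : SubdivVertex G) ∈ splitSet G (boundaryEdges G S)}
    (fun x => weight G τ S x) (2 * τ)
  flow_interCluster : FlowFromTo (subCap G (primed G S)) 2
    {x | (x : SubdivVertex G) ∈ splitSet G Y}
    {x | (x : SubdivVertex G) ∈ splitSet G (interClusterEdges G Z)}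
    (fun x => weight G τ S x) 2
  separates : ∀ xb ∈ splitSet G (boundaryEdges G S), ∀ xf ∈ splitSet G (interClusterEdges G Z),
    ¬ ReachableWithin (subdivision G) (primed G S \ splitSet G Y) xb xf

/-- The part `R` of `S` induced by `Y`: the vertices of `S` that can reach a vertex of
`X_B ∖ X_Y` in `G'[S'] ∖ X_Y`. -/
def outerPart (G : SimpleGraph V) (S : Finset V) (Y : Set (Sym2 V)) : Finset V :=
  S.filter fun v => ∃ xb ∈ splitSet G (boundaryEdges G S) \ splitSet G Y,
    ReachableWithin (subdivision G) (primed G S \ splitSet G Y) (.orig v) xb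

/-- The core `L = S ∖ R` of `S`. -/
def core (G : SimpleGraph V) (S : Finset V) (Y : Set (Sym2 V)) : Finset V :=
  S \ outerPart G S Y

/-- The sub-clusters `S₁, …, S_t` of `S`: the non-empty ones among `L ∩ Z_i` and `R ∩ Z_i`. -/
def subClusters (G : SimpleGraph V) {S : Finset V} (Z : Finpartition S) (Y : Set (Sym2 V)) :
    Finset (Finset V) :=
  (Z.parts.image (fun A => core G S Y ∩ A) ∪
    Z.parts.image (fun A => outerPart G S Y ∩ A)).filter Finset.Nonempty

/-! ### The hierarchical decomposition tree -/

/-- The vertex set of a hierarchical decomposition tree of `V`: a laminar family of non-empty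
clusters whose root is `V` and whose leaves are the singletons. -/
structure IsHierarchy [Fintype V] (T : Finset (Finset V)) : Prop where
  univ_mem : Finset.univ ∈ T
  singleton_mem : ∀ v : V, {v} ∈ T
  nonempty : ∀ C ∈ T, C.Nonempty
  laminar : ∀ C ∈ T, ∀ D ∈ T, C ⊆ D ∨ D ⊆ C ∨ Disjoint C D

/-- `D` is the parent of `C` in the tree: the smallest cluster that properly contains `C`. -/
def IsParent (T : Finset (Finset V)) (D C : Finset V) : Prop :=
  C ⊂ D ∧ ∀ E ∈ T, C ⊂ E → ¬ E ⊂ D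

/-- The capacities of the tree: the edge between a cluster `C` and its parent has the capacity of
`(C, V ∖ C)` in `G`. -/
def treeCap [Fintype V] (G : SimpleGraph V) (T : Finset (Finset V)) (C D : T) : ℝ :=
  if IsParent T D C then cutCap (unitCap G) (C : Finset V)
  else if IsParent T C D then cutCap (unitCap G) (D : Finset V)
  else 0

/-- A demand state on `V`, viewed as a demand state on the tree that lives on its leaves `{v}`. -/
def toTree [Fintype V] (T : Finset (Finset V)) (P : V → K → ℝ) (C : T) (k : K) : ℝ :=
  ∑ v, if (C : Finset V) = {v} then P v k else 0

/-! ### The invariant -/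

/-- The demand state `Q` satisfies the invariant for the cluster `S` with load `α`, relative to the
demand state `P` on `V`. -/
structure SatisfiesInvariant [Fintype V] [Fintype K] (G : SimpleGraph V) (P : V → K → ℝ)
    (S : Finset V) (α : ℝ) (Q : SubdivVertex G → K → ℝ) : Prop where
  supported : ∀ x, x ∉ splitSet G (boundaryEdges G S) → ∀ k, Q x k = 0
  conserved : ∀ k, ∑ x : primed G S, Q x k = ∑ v ∈ S, P v k
  load_le : ∀ x ∈ primed G S, load Q x ≤ α

end MergePhase

end

/-! Write Q_L and Q_R for the total demand states of the sub-clusters inside the core L and inside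
R. By the cut property of Y, Q_L lives on Y ∪ F and Q_R on Y ∪ B (split vertices being identified
with edges). Pushing Q_L directly to B would be too expensive. Instead, the tree condition says that
the total demand of L is at most the capacity of its boundary, so it can be spread evenly over that
boundary, which lies in Y, as a state U of load at most 1 (`IsHierarchy.exists_spread`).

Replacing Q_L by U costs little: the part of the valid state Q_L - U on Y is transported to F, and
what then lies on F is valid and is paid for by the expansion of F (`FlowFromTo.exists_transport`,
`Expands.mul_dem_le`). Now Q_R + U lives on Y ∪ B. Its part on B stays there, with load at most α,
because a boundary edge has only one endpoint in S, and this endpoint is in L or in R but not in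
both. The rest, of load at most 3α, is transported from Y to B; each sink receives at most 2τ units
of flow, so the load grows by only 6ατ. `exists_reroute` carries this out for abstract sets Y, B, F,
and `exists_merge` supplies the supports and loads. -/

namespace MergePhase

/-! ### Demands, cuts, flows and expansion -/

section Cuts

variable {W K : Type*} [Fintype K]

theorem load_add_le (P Q : W → K → ℝ) (v : W) :
    load (fun x k => P x k + Q x k) v ≤ load P v + load Q v := by
  unfold load
  rw [← Finset.sum_add_distrib]
  exact Finset.sum_le_sum fun k _ => abs_add_le _ _

theorem load_sub_le (P Q : W → K → ℝ) (v : W) :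
    load (fun x k => P x k - Q x k) v ≤ load P v + load Q v := by
  unfold load
  rw [← Finset.sum_add_distrib]
  exact Finset.sum_le_sum fun k _ => abs_sub _ _

theorem load_eq_zero {P : W → K → ℝ} {v : W} (h : ∀ k, P v k = 0) : load P v = 0 := by
  simp [load, h]

theorem load_ite_le (p : W → Prop) [DecidablePred p] (P : W → K → ℝ) (v : W) :
    load (fun x k => if p x then P x k else 0) v ≤ load P v := by
  unfold load
  refine Finset.sum_le_sum fun k _ => ?_
  dsimp only
  split_ifs <;> simp

theorem dem_add_le (P Q : W → K → ℝ) (A : Finset W) :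
    dem (fun x k => P x k + Q x k) A ≤ dem P A + dem Q A := by
  unfold dem
  rw [← Finset.sum_add_distrib]
  refine Finset.sum_le_sum fun k _ => ?_
  rw [Finset.sum_add_distrib]
  exact abs_add_le _ _

theorem dem_le_mul_ncard {N : W → K → ℝ} {X : Set W} (hN : ∀ x ∉ X, ∀ k, N x k = 0) {l : ℝ}
    (hl : ∀ x, load N x ≤ l) (A : Finset W) :
    dem N A ≤ l * ((X ∩ (A : Set W)).ncard : ℝ) := by
  have h1 : dem N A ≤ ∑ x ∈ A, load N x := by
    unfold dem load
    rw [Finset.sum_comm]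
    exact Finset.sum_le_sum fun k _ => Finset.abs_sum_le_sum_abs _ _
  have h2 : ∑ x ∈ A, load N x = ∑ x ∈ A.filter (· ∈ X), load N x := by
    rw [Finset.sum_filter]
    refine Finset.sum_congr rfl fun x _ => ?_
    split_ifs with hx
    · rfl
    · exact load_eq_zero (hN x hx)
  have h3 : (X ∩ (A : Set W)).ncard = (A.filter (· ∈ X)).card := by
    rw [← Set.ncard_coe_finset]
    congr 1
    ext x
    simp [and_comm]
  rw [h3]
  refine (h1.trans_eq h2).trans ((Finset.sum_le_card_nsmul _ _ l fun x _ => hl x).trans_eq ?_)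
  rw [nsmul_eq_mul, mul_comm]

theorem unitCap_nonneg (H : SimpleGraph W) (a b : W) : 0 ≤ unitCap H a b := by
  unfold unitCap
  split_ifs <;> simp

variable [Fintype W]

theorem cutCap_nonneg {c : W → W → ℝ} (hc : ∀ a b, 0 ≤ c a b) (A : Finset W) :
    0 ≤ cutCap c A :=
  Finset.sum_nonneg fun _ _ => Finset.sum_nonneg fun _ _ => hc _ _

/-- The net amount leaving a vertex set is carried by the edges across its boundary. -/
theorem sum_net_flow (f : W → W → ℝ) (A : Finset W) :
    ∑ v ∈ A, (∑ b, f v b - ∑ b, f b v) = ∑ a ∈ A, ∑ b ∈ Aᶜ, (f a b - f b a) := by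
  have h1 : ∀ v, ∑ b, f v b - ∑ b, f b v
      = ∑ b ∈ A, (f v b - f b v) + ∑ b ∈ Aᶜ, (f v b - f b v) := by
    intro v
    rw [Finset.sum_add_sum_compl, Finset.sum_sub_distrib]
  have h2 : ∑ v ∈ A, ∑ b ∈ A, (f v b - f b v) = 0 := by
    simp only [Finset.sum_sub_distrib]
    rw [Finset.sum_comm, sub_self]
  rw [Finset.sum_congr rfl fun v _ => h1 v, Finset.sum_add_distrib, h2, zero_add]

/-- A routable demand matrix respects cuts. -/
theorem Routable.sum_cross_le {c : W → W → ℝ} {κ : ℝ} {D : W → W → ℝ} (h : Routable c κ D)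
    (A : Finset W) :
    ∑ s, |(if s ∈ A then ∑ t, D s t else 0) - ∑ t ∈ A, D s t| ≤ κ * cutCap c A := by
  obtain ⟨f, hf0, hf, hcong⟩ := h
  -- The net amount of the commodity of source `s` leaving `A` is carried by the crossing edges.
  -- Absolute values are taken per source, so the sum over `s` is what the congestion limits.
  have h1 : ∀ s, |(if s ∈ A then ∑ t, D s t else 0) - ∑ t ∈ A, D s t|
      ≤ ∑ a ∈ A, ∑ b ∈ Aᶜ, (f s a b + f s b a) := by
    intro s
    have h2 : (if s ∈ A then ∑ t, D s t else 0) - ∑ t ∈ A, D s t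
        = ∑ a ∈ A, ∑ b ∈ Aᶜ, (f s a b - f s b a) := by
      rw [← sum_net_flow, Finset.sum_congr rfl fun v _ => hf s v, Finset.sum_sub_distrib]
      simp
    rw [h2]
    refine (Finset.abs_sum_le_sum_abs _ _).trans (Finset.sum_le_sum fun a _ => ?_)
    refine (Finset.abs_sum_le_sum_abs _ _).trans (Finset.sum_le_sum fun b _ => ?_)
    refine (abs_sub _ _).trans ?_
    rw [abs_of_nonneg (hf0 _ _ _), abs_of_nonneg (hf0 _ _ _)]
  refine (Finset.sum_le_sum fun s _ => h1 s).trans ?_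
  rw [Finset.sum_comm, cutCap, Finset.mul_sum]
  refine Finset.sum_le_sum fun a _ => ?_
  rw [Finset.sum_comm, Finset.mul_sum]
  exact Finset.sum_le_sum fun b _ => hcong a b

/-- A demand state that lives on the sources of a flow can be moved to its sinks. -/
theorem FlowFromTo.exists_transport {c : W → W → ℝ} {κ : ℝ} {X Y : Set W} {out : W → ℝ} {cap : ℝ}
    (h : FlowFromTo c κ X Y out cap) (hout : ∀ s ∈ X, 0 < out s) {l : ℝ} (hl : 0 ≤ l)
    (hcap : 0 ≤ cap)
    (M : W → K → ℝ) (hM : ∀ x ∉ X, ∀ k, M x k = 0) (hload : ∀ s ∈ X, load M s ≤ l * out s) :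
    ∃ M' : W → K → ℝ, (∀ x ∉ Y, ∀ k, M' x k = 0) ∧ (∀ x, load M' x ≤ l * cap) ∧
      (∀ k, ∑ x, M' x k = ∑ x, M x k) ∧
      ∀ A, dem (fun x k => M x k - M' x k) A ≤ l * κ * cutCap c A := by
  obtain ⟨D, hD0, hDs, hDout, hDcap, hR⟩ := h
  have hrow : ∀ s ∉ X, ∀ t, D s t = 0 := fun s hs t => by
    by_contra hne
    exact hs (hDs s t hne).1
  have hscale : ∀ s k, M s k / out s * ∑ t, D s t = M s k := by
    intro s k
    by_cases hs : s ∈ X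
    · rw [hDout s hs, div_mul_cancel₀ _ (hout s hs).ne']
    · simp [hM s hs k]
  have hfrac : ∀ s, ∑ k, |M s k / out s| ≤ l := by
    intro s
    by_cases hs : s ∈ X
    · have h1 := hload s hs
      simp only [abs_div, abs_of_pos (hout s hs)]
      rw [← Finset.sum_div, div_le_iff₀ (hout s hs)]
      exact h1
    · simpa [hM s hs] using hl
  -- Each source distributes every commodity over the sinks in proportion to `D s t`. By `hfrac` the
  -- ratios `M s k / out s` have total absolute value at most `l` over all `k`, so load and demand
  -- are at most `l` times those of the flow itself.
  refine ⟨fun t k => ∑ s, M s k / out s * D s t, ?_, ?_, ?_, ?_⟩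
  · intro x hx k
    refine Finset.sum_eq_zero fun s _ => ?_
    have : D s x = 0 := by
      by_contra hne
      exact hx (hDs s x hne).2
    rw [this, mul_zero]
  · intro x
    have hcol : ∑ s, D s x ≤ cap := by
      by_cases hx : x ∈ Y
      · exact hDcap x hx
      · rw [Finset.sum_eq_zero]
        · exact hcap
        · intro s _
          by_contra hne
          exact hx (hDs s x hne).2
    calc load (fun t k => ∑ s, M s k / out s * D s t) x
        ≤ ∑ k, ∑ s, |M s k / out s| * D s x := by
          refine Finset.sum_le_sum fun k _ => (Finset.abs_sum_le_sum_abs _ _).trans ?_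
          refine Finset.sum_le_sum fun s _ => ?_
          rw [abs_mul, abs_of_nonneg (hD0 s x)]
      _ = ∑ s, (∑ k, |M s k / out s|) * D s x := by
          rw [Finset.sum_comm]
          simp only [Finset.sum_mul]
      _ ≤ ∑ s, l * D s x :=
          Finset.sum_le_sum fun s _ => mul_le_mul_of_nonneg_right (hfrac s) (hD0 s x)
      _ = l * ∑ s, D s x := by rw [Finset.mul_sum]
      _ ≤ l * cap := mul_le_mul_of_nonneg_left hcol hl
  · intro k
    rw [Finset.sum_comm]
    refine Finset.sum_congr rfl fun s _ => ?_
    rw [← Finset.mul_sum, hscale]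
  · intro A
    have hnet : ∀ k, ∑ x ∈ A, (M x k - ∑ s, M s k / out s * D s x)
        = ∑ s, M s k / out s * ((if s ∈ A then ∑ t, D s t else 0) - ∑ t ∈ A, D s t) := by
      intro k
      simp only [mul_sub, Finset.sum_sub_distrib, mul_ite, mul_zero, hscale]
      congr 1
      · simp
      · rw [Finset.sum_comm]
        simp only [Finset.mul_sum]
    calc dem (fun x k => M x k - ∑ s, M s k / out s * D s x) A
        ≤ ∑ k, ∑ s, |M s k / out s| *
            |(if s ∈ A then ∑ t, D s t else 0) - ∑ t ∈ A, D s t| := by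
          unfold dem
          refine Finset.sum_le_sum fun k _ => ?_
          rw [hnet]
          refine (Finset.abs_sum_le_sum_abs _ _).trans (Finset.sum_le_sum fun s _ => ?_)
          rw [abs_mul]
      _ = ∑ s, (∑ k, |M s k / out s|) *
            |(if s ∈ A then ∑ t, D s t else 0) - ∑ t ∈ A, D s t| := by
          rw [Finset.sum_comm]
          simp only [Finset.sum_mul]
      _ ≤ ∑ s, l * |(if s ∈ A then ∑ t, D s t else 0) - ∑ t ∈ A, D s t| :=
          Finset.sum_le_sum fun s _ => mul_le_mul_of_nonneg_right (hfrac s) (abs_nonneg _)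
      _ = l * ∑ s, |(if s ∈ A then ∑ t, D s t else 0) - ∑ t ∈ A, D s t| := by
          rw [Finset.mul_sum]
      _ ≤ l * (κ * cutCap c A) := mul_le_mul_of_nonneg_left (hR.sum_cross_le A) hl
      _ = l * κ * cutCap c A := by ring

theorem IsValid.dem_compl {N : W → K → ℝ} (hN : IsValid N) (A : Finset W) :
    dem N Aᶜ = dem N A := by
  unfold dem
  refine Finset.sum_congr rfl fun k _ => ?_
  have h := hN k
  rw [← Finset.sum_add_sum_compl A] at h
  rw [← abs_neg]
  congr 1
  linarith

/-- A valid demand state that lives on an expanding set respects the cuts. -/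
theorem Expands.mul_dem_le {c : W → W → ℝ} {φ : ℝ} {X : Set W} (h : Expands c φ X) (hφ : 0 ≤ φ)
    {N : W → K → ℝ} (hN : ∀ x ∉ X, ∀ k, N x k = 0) (hv : IsValid N) {l : ℝ} (hl0 : 0 ≤ l)
    (hl : ∀ x, load N x ≤ l) (A : Finset W) : φ * dem N A ≤ l * cutCap c A := by
  have h1 := dem_le_mul_ncard hN hl A
  have h2 := dem_le_mul_ncard hN hl Aᶜ
  -- Validity makes the demand the same from both sides, so it can be charged to the side with fewer
  -- vertices of `X`.
  rw [hv.dem_compl, Finset.coe_compl, ← Set.sdiff_eq] at h2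
  have h3 : dem N A ≤ l * min ((X ∩ (A : Set W)).ncard : ℝ) ((X \ (A : Set W)).ncard : ℝ) := by
    rw [mul_min_of_nonneg _ _ hl0]
    exact le_min h1 h2
  calc φ * dem N A ≤ φ * (l * min _ _) := mul_le_mul_of_nonneg_left h3 hφ
    _ = l * (φ * min _ _) := by ring
    _ ≤ l * cutCap c A := mul_le_mul_of_nonneg_left (h A) hl0

/-- Expansion is inherited by larger graphs. -/
theorem Expands.image {W₁ : Type*} [Fintype W₁] {c₁ : W₁ → W₁ → ℝ} {c : W → W → ℝ} {φ : ℝ}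
    {X : Set W₁} (h : Expands c₁ φ X) {i : W₁ → W} (hi : Function.Injective i)
    (hc : ∀ a b, c₁ a b ≤ c (i a) (i b)) (hc0 : ∀ a b, 0 ≤ c a b) : Expands c φ (i '' X) := by
  intro A
  have h1 : i '' X ∩ (A : Set W) = i '' (X ∩ (Finset.univ.filter (i · ∈ A) : Finset W₁)) := by
    ext x
    simp only [Set.mem_inter_iff, Set.mem_image, Finset.coe_filter, Finset.mem_univ, true_and,
      Set.mem_ofPred_eq, Finset.mem_coe]
    constructor
    · rintro ⟨⟨y, hy, rfl⟩, hA⟩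
      exact ⟨y, ⟨hy, hA⟩, rfl⟩
    · rintro ⟨y, ⟨hy, hA⟩, rfl⟩
      exact ⟨⟨y, hy, rfl⟩, hA⟩
  have h2 : i '' X \ (A : Set W) = i '' (X \ (Finset.univ.filter (i · ∈ A) : Finset W₁)) := by
    ext x
    simp only [Set.mem_sdiff, Set.mem_image, Finset.coe_filter, Finset.mem_univ, true_and,
      Set.mem_ofPred_eq, Finset.mem_coe]
    constructor
    · rintro ⟨⟨y, hy, rfl⟩, hA⟩
      exact ⟨y, ⟨hy, hA⟩, rfl⟩
    · rintro ⟨y, ⟨hy, hA⟩, rfl⟩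
      exact ⟨⟨y, hy, rfl⟩, hA⟩
  rw [h1, h2, Set.ncard_image_of_injective _ hi, Set.ncard_image_of_injective _ hi]
  refine (h _).trans ?_
  unfold cutCap
  calc _ ≤ ∑ a ∈ Finset.univ.filter (i · ∈ A), ∑ b ∈ Aᶜ, c (i a) b := by
        refine Finset.sum_le_sum fun a _ => ?_
        refine (Finset.sum_le_sum fun b _ => hc a b).trans ?_
        rw [← Finset.sum_image (f := fun b => c (i a) b) hi.injOn]
        refine Finset.sum_le_sum_of_subset_of_nonneg ?_ fun _ _ _ => hc0 _ _
        intro b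
        simp only [Finset.mem_image, Finset.mem_compl, Finset.mem_filter, Finset.mem_univ, true_and]
        rintro ⟨y, hy, rfl⟩
        exact hy
    _ ≤ _ := by
        rw [← Finset.sum_image (f := fun a => ∑ b ∈ Aᶜ, c a b) hi.injOn]
        refine Finset.sum_le_sum_of_subset_of_nonneg ?_ fun _ _ _ =>
          Finset.sum_nonneg fun _ _ => hc0 _ _
        intro b
        simp only [Finset.mem_image, Finset.mem_filter, Finset.mem_univ, true_and]
        rintro ⟨y, hy, rfl⟩
        exact hy

end Cuts

theorem sum_subtype_of_support {X M : Type*} [AddCommMonoid M] [Fintype X] (U : Set X) [Fintype U]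
    (g : X → M) (h : ∀ x ∉ U, g x = 0) : ∑ x : U, g x = ∑ x, g x := by
  refine (Finset.sum_subtype (Finset.univ.filter (· ∈ U)) (p := (· ∈ U)) (F := ‹Fintype U›)
    (by simp) g).symm.trans ?_
  rw [Finset.sum_filter]
  refine Finset.sum_congr rfl fun x _ => ?_
  split_ifs with hx
  · rfl
  · exact (h x hx).symm

/-! ### The demand of a cluster of the tree -/

section Tree

variable {V K : Type*} [Fintype V]

/-- In a tree every cut below a single cluster costs at most the capacity of that cluster. -/
theorem IsHierarchy.cutCap_treeCap_le {T : Finset (Finset V)} (hT : IsHierarchy T)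
    (G : SimpleGraph V) {L : Finset V} (hL : L ∈ T) :
    cutCap (treeCap G T) (Finset.univ.filter fun C : T => (C : Finset V) ⊆ L)
      ≤ cutCap (unitCap G) L := by
  have hcap : 0 ≤ cutCap (unitCap G) L := cutCap_nonneg (unitCap_nonneg G) L
  -- The only tree edge leaving the subtree of `L` joins `L` to its parent: by laminarity a parent
  -- `D` of `C` that is not inside `L` strictly contains `L`, and if `C` were not `L`, then `L`
  -- would lie strictly between them.
  have hcross : ∀ C D : T, (C : Finset V) ⊆ L → ¬ (D : Finset V) ⊆ L →
      treeCap G T C D = if C = ⟨L, hL⟩ ∧ IsParent T D L then cutCap (unitCap G) L else 0 := by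
    intro C D hC hD
    have h2 : ¬ IsParent T C D := fun h => hD (h.1.subset.trans hC)
    unfold treeCap
    rw [if_neg h2]
    by_cases h1 : IsParent T D C
    · have hLD : L ⊂ D := by
        rcases hT.laminar L hL D D.2 with h | h | h
        · exact ⟨h, hD⟩
        · exact absurd h hD
        · exfalso
          obtain ⟨v, hv⟩ := hT.nonempty C C.2
          exact Finset.disjoint_left.1 h (hC hv) (h1.1.subset hv)
      have hCL : (C : Finset V) = L := by
        by_contra hne
        exact h1.2 L hL (hC.ssubset_of_ne hne) hLD
      have hC' : C = ⟨L, hL⟩ := Subtype.ext hCL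
      subst hC'
      simp [h1]
    · rw [if_neg h1, if_neg]
      rintro ⟨rfl, h⟩
      exact h1 h
  unfold cutCap
  refine (Finset.sum_congr rfl fun C hC => Finset.sum_congr rfl fun D hD =>
    hcross C D (by simpa using hC) (by simpa using hD)).trans_le ?_
  rw [Finset.sum_eq_single_of_mem (⟨L, hL⟩ : T) (by simp) fun C _ hne => by simp [hne]]
  simp only [true_and]
  rw [← Finset.sum_filter, Finset.sum_const, nsmul_eq_mul]
  -- `L` has at most one parent, since two of them would be nested; the root has none.
  refine mul_le_of_le_one_left hcap ?_
  norm_cast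
  rw [Finset.card_le_one]
  intro D hD E hE
  simp only [Finset.mem_filter] at hD hE
  have hDp := hD.2
  have hEp := hE.2
  obtain ⟨v, hv⟩ := hT.nonempty L hL
  rcases hT.laminar D D.2 E E.2 with h | h | h
  · by_contra hne
    exact hEp.2 D D.2 hDp.1 (h.ssubset_of_ne fun h => hne (Subtype.ext h))
  · by_contra hne
    exact hDp.2 E E.2 hEp.1 (h.ssubset_of_ne fun h => hne (Subtype.ext h.symm))
  · exact absurd (hEp.1.subset hv) (Finset.disjoint_left.1 h (hDp.1.subset hv))

theorem IsHierarchy.sum_toTree {T : Finset (Finset V)} (hT : IsHierarchy T) (P : V → K → ℝ)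
    (L : Finset V) (k : K) :
    ∑ C ∈ Finset.univ.filter (fun C : T => (C : Finset V) ⊆ L), toTree T P C k
      = ∑ v ∈ L, P v k := by
  have hv : ∀ v, (∑ C ∈ Finset.univ.filter (fun C : T => (C : Finset V) ⊆ L),
      if (C : Finset V) = {v} then P v k else 0) = if v ∈ L then P v k else 0 := by
    intro v
    rw [Finset.sum_filter, Finset.sum_eq_single (⟨{v}, hT.singleton_mem v⟩ : T)]
    · simp
    · intro C _ hne
      have : (C : Finset V) ≠ {v} := fun h => hne (Subtype.ext h)
      simp [this]
    · simp
  unfold toTree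
  rw [Finset.sum_comm, Finset.sum_congr rfl fun v _ => hv v]
  simp

variable [Fintype K]

/-- The demand that leaves a cluster of a tree that respects `P` is at most the capacity of the
cluster. -/
theorem IsHierarchy.sum_abs_le_cutCap {T : Finset (Finset V)} (hT : IsHierarchy T)
    {G : SimpleGraph V} {P : V → K → ℝ} (hP : Respects (treeCap G T) 1 (toTree T P))
    {L : Finset V} (hL : L ∈ T) : ∑ k, |∑ v ∈ L, P v k| ≤ cutCap (unitCap G) L := by
  have h := (hP (Finset.univ.filter fun C : T => (C : Finset V) ⊆ L)).trans
    (hT.cutCap_treeCap_le G hL)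
  unfold dem at h
  simpa only [hT.sum_toTree, one_mul] using h

end Tree

/-! ### Split vertices and their endpoints -/

section Subdivision

variable {V : Type*} {G : SimpleGraph V}

theorem split_mem_splitSet {F : Set (Sym2 V)} {e : G.edgeSet} :
    SubdivVertex.split e ∈ splitSet G F ↔ (e : Sym2 V) ∈ F := by
  constructor
  · rintro ⟨e', he', h⟩
    cases h
    exact he'
  · exact fun h => ⟨e, h, rfl⟩

theorem splitSet_mono {F F' : Set (Sym2 V)} (h : ∀ e ∈ F, e ∈ F') :
    splitSet G F ⊆ splitSet G F' := by
  rintro _ ⟨e, he, rfl⟩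
  exact ⟨e, h _ he, rfl⟩

theorem splitSet_boundaryEdges_subset_primed {C S : Finset V} (h : C ⊆ S) :
    splitSet G (boundaryEdges G C) ⊆ primed G S := by
  rintro _ ⟨e, ⟨-, u, hu, v, hv, he⟩, rfl⟩
  exact ⟨u, by simp [he], h hu⟩

/-- Orienting each boundary edge out of `L` matches it with exactly one ordered pair of the cut.
This gives an even spread over the boundary the right total. -/
theorem sum_splitSet_boundaryEdges [Fintype V] (L : Finset V) :
    ∑ x, (if x ∈ splitSet G (boundaryEdges G L) then (1 : ℝ) else 0) = cutCap (unitCap G) L := by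
  unfold cutCap unitCap
  rw [← Finset.sum_product', Finset.sum_boole, Finset.sum_boole]
  norm_cast
  symm
  refine Finset.card_bij
    (fun p hp => SubdivVertex.split ⟨s(p.1, p.2), (Finset.mem_filter.1 hp).2⟩) ?_ ?_ ?_
  · rintro ⟨a, b⟩ hp
    simp only [Finset.mem_filter, Finset.mem_product, Finset.mem_compl] at hp
    simp only [Finset.mem_filter, Finset.mem_univ, true_and, split_mem_splitSet]
    exact ⟨hp.2, a, hp.1.1, b, hp.1.2, rfl⟩
  · rintro ⟨a, b⟩ hp ⟨a', b'⟩ hp' h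
    simp only [Finset.mem_filter, Finset.mem_product, Finset.mem_compl] at hp hp'
    have h' : s(a, b) = s(a', b') := congrArg Subtype.val (SubdivVertex.split.inj h)
    rw [Sym2.eq_iff] at h'
    rcases h' with ⟨rfl, rfl⟩ | ⟨rfl, rfl⟩
    · rfl
    · exact absurd hp.1.1 hp'.1.2
  · intro x hx
    simp only [Finset.mem_filter, Finset.mem_univ, true_and] at hx
    obtain ⟨⟨e, hG⟩, ⟨-, u, hu, v, hv, he⟩, rfl⟩ := hx
    simp only at he
    subst he
    exact ⟨(u, v), by simpa [hu, hv] using hG, rfl⟩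

/-- The number of neighbours in `D` of a vertex of the subdivision graph. -/
noncomputable def endpointCount (G : SimpleGraph V) (D : Finset V) (x : SubdivVertex G) : ℝ :=
  ∑ v ∈ D, if (subdivision G).Adj x (.orig v) then 1 else 0

theorem one_le_endpointCount {D : Finset V} {x : SubdivVertex G} {v : V} (hv : v ∈ D)
    (h : (subdivision G).Adj x (.orig v)) : 1 ≤ endpointCount G D x := by
  have := Finset.single_le_sum (s := D)
    (f := fun v => if (subdivision G).Adj x (.orig v) then (1 : ℝ) else 0)
    (fun v _ => by split_ifs <;> simp) hv
  rwa [if_pos h] at this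

theorem endpointCount_nonneg (D : Finset V) (x : SubdivVertex G) : 0 ≤ endpointCount G D x :=
  Finset.sum_nonneg fun v _ => by split_ifs <;> simp

theorem endpointCount_le_card {D s : Finset V} {x : SubdivVertex G}
    (h : ∀ v ∈ D, (subdivision G).Adj x (.orig v) → v ∈ s) : endpointCount G D x ≤ s.card := by
  unfold endpointCount
  rw [Finset.sum_boole]
  norm_cast
  refine Finset.card_le_card fun v hv => ?_
  rw [Finset.mem_filter] at hv
  exact h v hv.1 hv.2

theorem endpointCount_le_two (D : Finset V) (x : SubdivVertex G) : endpointCount G D x ≤ 2 := by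
  rcases x with w | ⟨e, he⟩
  · refine (endpointCount_le_card (x := .orig w) (s := ∅) fun v _ h => False.elim h).trans (by simp)
  · induction e with
    | _ u w =>
      refine (endpointCount_le_card (s := {u, w}) fun v _ h => ?_).trans ?_
      · have : v ∈ s(u, w) := h
        simpa using this
      · exact_mod_cast Finset.card_le_two

/-- The other end of a boundary edge is outside `S`. This keeps the load on `B` at `α` where the
general bound would give `2 * α`. -/
theorem endpointCount_le_one {S : Finset V} {x : SubdivVertex G}
    (hx : x ∈ splitSet G (boundaryEdges G S)) : endpointCount G S x ≤ 1 := by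
  obtain ⟨e, ⟨-, u, hu, v, hv, he⟩, rfl⟩ := hx
  refine (endpointCount_le_card (s := {u}) fun w hw h => ?_).trans (by simp)
  have : w ∈ (e : Sym2 V) := h
  rw [he, Sym2.mem_iff] at this
  rcases this with rfl | rfl
  · simp
  · exact absurd hw hv

theorem one_le_endpointCount_of_boundary {S : Finset V} {x : SubdivVertex G}
    (hx : x ∈ splitSet G (boundaryEdges G S)) : 1 ≤ endpointCount G S x := by
  obtain ⟨e, ⟨-, u, hu, v, hv, he⟩, rfl⟩ := hx
  refine one_le_endpointCount hu ?_
  change u ∈ (e : Sym2 V)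
  simp [he]

theorem SatisfiesInvariant.sum_eq [Fintype V] {K : Type*} [Fintype K] {P : V → K → ℝ}
    {C : Finset V} {α : ℝ} {Q : SubdivVertex G → K → ℝ} (h : SatisfiesInvariant G P C α Q) (k : K) :
    ∑ x, Q x k = ∑ v ∈ C, P v k := by
  rw [← h.conserved k]
  refine (sum_subtype_of_support _ _ fun x hx => ?_).symm
  exact h.supported x (fun hb => hx (splitSet_boundaryEdges_subset_primed subset_rfl hb)) k

/-- The load of a boundary edge is charged to an endpoint in `C`. In this form the bound is additive
over disjoint clusters, however many of them share an edge. -/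
theorem SatisfiesInvariant.load_le_endpointCount [Fintype V] {K : Type*} [Fintype K]
    {P : V → K → ℝ} {C : Finset V} {α : ℝ} (hα : 0 ≤ α) {Q : SubdivVertex G → K → ℝ}
    (h : SatisfiesInvariant G P C α Q) (x : SubdivVertex G) :
    load Q x ≤ α * endpointCount G C x := by
  by_cases hx : x ∈ splitSet G (boundaryEdges G C)
  · refine (h.load_le x (splitSet_boundaryEdges_subset_primed subset_rfl hx)).trans ?_
    exact le_mul_of_one_le_right hα (one_le_endpointCount_of_boundary hx)
  · rw [load_eq_zero (h.supported x hx)]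
    exact mul_nonneg hα (endpointCount_nonneg _ _)

end Subdivision

/-! ### Sub-clusters and the sums of their demand states -/

section Pieces

variable {V : Type*}

/-- The partition of `D ⊆ S` induced by a partition of `S`. -/
noncomputable def pieces {S : Finset V} (Z : Finpartition S) (D : Finset V) : Finset (Finset V) :=
  (Z.parts.image (D ∩ ·)).filter Finset.Nonempty

theorem mem_pieces {S : Finset V} {Z : Finpartition S} {D C : Finset V} :
    C ∈ pieces Z D ↔ (∃ A ∈ Z.parts, D ∩ A = C) ∧ C.Nonempty := by
  simp [pieces]

theorem subset_of_mem_pieces {S : Finset V} {Z : Finpartition S} {D C : Finset V}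
    (h : C ∈ pieces Z D) : C ⊆ D := by
  obtain ⟨⟨A, _, rfl⟩, _⟩ := mem_pieces.1 h
  exact Finset.inter_subset_left

theorem sum_pieces {S : Finset V} (Z : Finpartition S) {D : Finset V} (hD : D ⊆ S) (g : V → ℝ) :
    ∑ C ∈ pieces Z D, ∑ v ∈ C, g v = ∑ v ∈ D, g v := by
  have hdisj : Set.PairwiseDisjoint (pieces Z D : Set (Finset V)) id := by
    intro C hC C' hC' hne
    obtain ⟨⟨A, hA, rfl⟩, _⟩ := mem_pieces.1 hC
    obtain ⟨⟨A', hA', rfl⟩, _⟩ := mem_pieces.1 hC'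
    have hAA : A ≠ A' := fun h => hne (by rw [h])
    exact (Z.disjoint hA hA' hAA).mono Finset.inter_subset_right Finset.inter_subset_right
  rw [← Finset.sum_biUnion (t := fun C => C) hdisj]
  congr 1
  ext v
  simp only [Finset.mem_biUnion]
  constructor
  · rintro ⟨C, hC, hv⟩
    exact subset_of_mem_pieces hC hv
  · intro hv
    obtain ⟨A, hA, hvA⟩ := Z.exists_mem (hD hv)
    have hv' : v ∈ D ∩ A := Finset.mem_inter.2 ⟨hv, hvA⟩
    exact ⟨D ∩ A, mem_pieces.2 ⟨⟨A, hA, rfl⟩, ⟨v, hv'⟩⟩, hv'⟩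

theorem outerPart_subset {G : SimpleGraph V} {S : Finset V} {Y : Set (Sym2 V)} :
    outerPart G S Y ⊆ S :=
  Finset.filter_subset _ _

theorem core_subset {G : SimpleGraph V} {S : Finset V} {Y : Set (Sym2 V)} : core G S Y ⊆ S :=
  Finset.sdiff_subset

theorem subClusters_eq (G : SimpleGraph V) {S : Finset V} (Z : Finpartition S) (Y : Set (Sym2 V)) :
    subClusters G Z Y = pieces Z (core G S Y) ∪ pieces Z (outerPart G S Y) :=
  Finset.filter_union _ _ _

theorem disjoint_pieces (G : SimpleGraph V) {S : Finset V} (Z : Finpartition S) (Y : Set (Sym2 V)) :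
    Disjoint (pieces Z (core G S Y)) (pieces Z (outerPart G S Y)) := by
  rw [Finset.disjoint_left]
  intro C hC hC'
  obtain ⟨v, hv⟩ := (mem_pieces.1 hC).2
  exact (Finset.mem_sdiff.1 (subset_of_mem_pieces hC hv)).2 (subset_of_mem_pieces hC' hv)

variable {G : SimpleGraph V} [Fintype V] {K : Type*} [Fintype K] {P : V → K → ℝ} {S : Finset V}
  {Z : Finpartition S} {D : Finset V} {α : ℝ} {Q : Finset V → SubdivVertex G → K → ℝ}

theorem sum_sum_pieces (hD : D ⊆ S) (hQ : ∀ C ∈ pieces Z D, SatisfiesInvariant G P C α (Q C))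
    (k : K) : ∑ x, ∑ C ∈ pieces Z D, Q C x k = ∑ v ∈ D, P v k := by
  rw [Finset.sum_comm, Finset.sum_congr rfl fun C hC => (hQ C hC).sum_eq k, sum_pieces Z hD]

theorem load_sum_pieces_le (hD : D ⊆ S) (hα : 0 ≤ α)
    (hQ : ∀ C ∈ pieces Z D, SatisfiesInvariant G P C α (Q C)) (x : SubdivVertex G) :
    load (fun x k => ∑ C ∈ pieces Z D, Q C x k) x ≤ α * endpointCount G D x := by
  calc load (fun x k => ∑ C ∈ pieces Z D, Q C x k) x
      ≤ ∑ C ∈ pieces Z D, load (Q C) x := by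
        unfold load
        rw [Finset.sum_comm]
        exact Finset.sum_le_sum fun k _ => Finset.abs_sum_le_sum_abs _ _
    _ ≤ ∑ C ∈ pieces Z D, α * endpointCount G C x :=
        Finset.sum_le_sum fun C hC => (hQ C hC).load_le_endpointCount hα x
    _ = α * endpointCount G D x := by
        rw [← Finset.mul_sum]
        unfold endpointCount
        rw [sum_pieces Z hD]

theorem sum_pieces_eq_zero (hQ : ∀ C ∈ pieces Z D, SatisfiesInvariant G P C α (Q C))
    {x : SubdivVertex G} (hx : ∀ C ∈ pieces Z D, x ∉ splitSet G (boundaryEdges G C)) (k : K) :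
    ∑ C ∈ pieces Z D, Q C x k = 0 :=
  Finset.sum_eq_zero fun C hC => (hQ C hC).supported x (hx C hC) k

end Pieces

/-! ### Where the boundaries of the sub-clusters lie -/

section Cut

variable {V : Type*} {G : SimpleGraph V} {S : Finset V} {Y : Set (Sym2 V)}

theorem ReachableWithin.cons {W : Type*} {H : SimpleGraph W} {U : Set W} {a b c : W}
    (h : H.Adj a b) (ha : a ∈ U) (hb : ReachableWithin H U b c) : ReachableWithin H U a c := by
  obtain ⟨p, hp⟩ := hb
  refine ⟨.cons h p, fun y hy => ?_⟩
  rw [SimpleGraph.Walk.support_cons, List.mem_cons] at hy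
  rcases hy with rfl | hy
  · exact ha
  · exact hp y hy

theorem ReachableWithin.refl {W : Type*} {H : SimpleGraph W} {U : Set W} {a : W} (ha : a ∈ U) :
    ReachableWithin H U a a :=
  ⟨.nil, fun y hy => by simp at hy; exact hy ▸ ha⟩

theorem ReachableWithin.symm {W : Type*} {H : SimpleGraph W} {U : Set W} {a b : W}
    (h : ReachableWithin H U a b) : ReachableWithin H U b a := by
  obtain ⟨p, hp⟩ := h
  exact ⟨p.reverse, fun y hy => hp y (by simpa using hy)⟩

theorem orig_mem_primed_diff {v : V} (hv : v ∈ S) :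
    SubdivVertex.orig v ∈ primed G S \ splitSet G Y :=
  ⟨hv, by rintro ⟨e, -, h⟩; cases h⟩

theorem split_mem_primed_diff {v : V} (hv : v ∈ S) {e : G.edgeSet} (hve : v ∈ (e : Sym2 V))
    (he : (e : Sym2 V) ∉ Y) : SubdivVertex.split e ∈ primed G S \ splitSet G Y :=
  ⟨⟨v, hve, hv⟩, fun h => he (split_mem_splitSet.1 h)⟩

theorem mem_outerPart {v : V} : v ∈ outerPart G S Y ↔
    v ∈ S ∧ ∃ xb ∈ splitSet G (boundaryEdges G S) \ splitSet G Y,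
      ReachableWithin (subdivision G) (primed G S \ splitSet G Y) (.orig v) xb :=
  Finset.mem_filter

theorem mem_outerPart_of_edge {u v : V} (hv : v ∈ outerPart G S Y) (hu : u ∈ S)
    (he : s(u, v) ∈ G.edgeSet) (heY : s(u, v) ∉ Y) : u ∈ outerPart G S Y := by
  obtain ⟨hvS, xb, hxb, h⟩ := mem_outerPart.1 hv
  refine mem_outerPart.2 ⟨hu, xb, hxb, ?_⟩
  have h1 : (subdivision G).Adj (.split ⟨s(u, v), he⟩) (.orig v) := Sym2.mem_mk_right u v
  have h2 : (subdivision G).Adj (.orig u) (.split ⟨s(u, v), he⟩) := Sym2.mem_mk_left u v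
  exact (h.cons h1 (split_mem_primed_diff hvS (Sym2.mem_mk_right u v) heY)).cons h2
    (orig_mem_primed_diff hu)

theorem mem_outerPart_of_boundary {u v : V} (hu : u ∈ S) (hv : v ∉ S)
    (he : s(u, v) ∈ G.edgeSet) (heY : s(u, v) ∉ Y) : u ∈ outerPart G S Y := by
  refine mem_outerPart.2 ⟨hu, .split ⟨s(u, v), he⟩, ⟨split_mem_splitSet.2 ⟨he, u, hu, v, hv, rfl⟩,
    fun h => heY (split_mem_splitSet.1 h)⟩, ?_⟩
  have h2 : (subdivision G).Adj (.orig u) (.split ⟨s(u, v), he⟩) := Sym2.mem_mk_left u v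
  exact (ReachableWithin.refl (split_mem_primed_diff hu (Sym2.mem_mk_left u v) heY)).cons h2
    (orig_mem_primed_diff hu)

/-- An edge outside `Y` that leaves the core ends in R or outside `S`. Either way it lets its core
endpoint reach an uncut boundary edge, which would put that endpoint in R. -/
theorem boundaryEdges_core_subset {e : Sym2 V} (he : e ∈ boundaryEdges G (core G S Y)) :
    e ∈ Y := by
  obtain ⟨hG, u, hu, v, hv, rfl⟩ := he
  by_contra heY
  rw [core, Finset.mem_sdiff] at hu hv
  by_cases hvS : v ∈ S
  · have hvR : v ∈ outerPart G S Y := by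
      by_contra h
      exact hv ⟨hvS, h⟩
    exact hu.2 (mem_outerPart_of_edge hvR hu.1 hG heY)
  · exact hu.2 (mem_outerPart_of_boundary hu.1 hvS hG heY)

variable {Z : Finpartition S}

theorem mem_interClusterEdges {u v : V} {A : Finset V} (hA : A ∈ Z.parts) (hu : u ∈ A)
    (hvS : v ∈ S) (hv : v ∉ A) (he : s(u, v) ∈ G.edgeSet) :
    s(u, v) ∈ interClusterEdges G Z := by
  obtain ⟨B, hB, hvB⟩ := Z.exists_mem hvS
  exact ⟨he, A, hA, B, hB, fun h => hv (h ▸ hvB), u, hu, v, hvB, rfl⟩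

theorem interClusterEdges_subset {e : Sym2 V} (he : e ∈ interClusterEdges G Z) {v : V}
    (hv : v ∈ e) : v ∈ S := by
  obtain ⟨-, A, hA, B, hB, -, u, hu, w, hw, rfl⟩ := he
  rw [Sym2.mem_iff] at hv
  rcases hv with rfl | rfl
  · exact Z.le hA hu
  · exact Z.le hB hw

theorem boundaryEdges_pieces_core_subset {C : Finset V} (hC : C ∈ pieces Z (core G S Y))
    {e : Sym2 V} (he : e ∈ boundaryEdges G C) : e ∈ Y ∪ interClusterEdges G Z := by
  obtain ⟨⟨A, hA, rfl⟩, -⟩ := mem_pieces.1 hC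
  obtain ⟨hG, u, hu, v, hv, rfl⟩ := he
  rw [Finset.mem_inter] at hu hv
  by_cases hvL : v ∈ core G S Y
  · exact Or.inr (mem_interClusterEdges hA hu.2 (core_subset hvL) (fun h => hv ⟨hvL, h⟩) hG)
  · exact Or.inl (boundaryEdges_core_subset ⟨hG, u, hu.1, v, hvL, rfl⟩)

/-- An edge outside `Y` from R to another vertex of `S` keeps that vertex in R, so it leaves the
piece only by changing parts. As an edge of F it would then complete a path from B to F avoiding
`Y`. -/
theorem IsBottleneckCut.boundaryEdges_pieces_outerPart_subset [Fintype V] {τ : ℝ}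
    (hY : IsBottleneckCut G τ Z Y) {C : Finset V} (hC : C ∈ pieces Z (outerPart G S Y))
    {e : Sym2 V} (he : e ∈ boundaryEdges G C) : e ∈ Y ∪ boundaryEdges G S := by
  obtain ⟨⟨A, hA, rfl⟩, -⟩ := mem_pieces.1 hC
  obtain ⟨hG, u, hu, v, hv, rfl⟩ := he
  rw [Finset.mem_inter] at hu hv
  have huS := outerPart_subset hu.1
  by_cases hvS : v ∈ S
  · left
    by_contra heY
    have hvR : v ∈ outerPart G S Y :=
      mem_outerPart_of_edge hu.1 hvS (Sym2.eq_swap ▸ hG) (Sym2.eq_swap ▸ heY)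
    have hF := mem_interClusterEdges hA hu.2 hvS (fun h => hv ⟨hvR, h⟩) hG
    obtain ⟨-, xb, hxb, h⟩ := mem_outerPart.1 hu.1
    have h1 : (subdivision G).Adj (.split ⟨s(u, v), hG⟩) (.orig u) := Sym2.mem_mk_left u v
    exact hY.separates xb hxb.1 _ (split_mem_splitSet.2 hF)
      (h.cons h1 (split_mem_primed_diff huS (Sym2.mem_mk_left u v) heY)).symm
  · exact Or.inr ⟨hG, u, huS, v, hvS, rfl⟩

/-- The expansion of the inter-cluster edges in `G'[S']`. -/
theorem IsFirstPartition.expands_primed [Fintype V] {c₀ : ℝ} (h : IsFirstPartition G c₀ Z) :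
    Expands (subCap G (primed G S)) (c₀ / Real.logb 2 (Fintype.card V))
      {x | (x : SubdivVertex G) ∈ splitSet G (interClusterEdges G Z)} := by
  have hsub : ∀ x ∈ splitSet G (interClusterEdges G Z), x ∈ innerPrimed G S := by
    rintro _ ⟨e, he, rfl⟩
    exact fun v hv => interClusterEdges_subset he hv
  have hin : innerPrimed G S ⊆ primed G S := by
    rintro (v | ⟨e, he⟩) hx
    · exact hx
    · induction e with
      | _ u w => exact ⟨u, Sym2.mem_mk_left u w, hx u (Sym2.mem_mk_left u w)⟩
  have himg := h.expands.image (c := subCap G (primed G S)) (Set.inclusion_injective hin)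
    (fun a b => le_of_eq rfl) (fun _ _ => unitCap_nonneg _ _ _)
  convert himg using 1
  ext x
  constructor
  · exact fun hx => ⟨⟨x, hsub x hx⟩, hx, rfl⟩
  · rintro ⟨y, hy, rfl⟩
    exact hy

end Cut

/-! ### Rerouting and the merge step -/

/-- Rerouting demand states across a separator `Y`: the state `QL` is replaced by `U`, which lives
on `Y`, and then all that lies on `Y` outside of `B` is moved to `B`. -/
theorem exists_reroute {W K : Type*} [Fintype W] [Fintype K] {c : W → W → ℝ}
    (hc0 : ∀ a b, 0 ≤ c a b) {Y B F : Set W} {τ φ α : ℝ} (hτ0 : 0 < τ) (hτ1 : τ ≤ 1) (hφ : 0 ≤ φ)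
    (hα : 1 ≤ α) {μ : W → ℝ} (hμB : ∀ x ∈ B, μ x = τ) (hμ : ∀ x ∉ B, μ x = 1)
    (hYB : FlowFromTo c 2 Y B μ (2 * τ)) (hYF : FlowFromTo c 2 Y F μ 2) (hF : Expands c φ F)
    {QL QR U : W → K → ℝ} (hQL : ∀ x, x ∉ Y → x ∉ F → ∀ k, QL x k = 0)
    (hQR : ∀ x, x ∉ Y → x ∉ B → ∀ k, QR x k = 0) (hU : ∀ x ∉ Y, ∀ k, U x k = 0)
    (hsum : ∀ k, ∑ x, QL x k = ∑ x, U x k) (hQL_load : ∀ x, load QL x ≤ 2 * α)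
    (hQR_load : ∀ x, load QR x ≤ 2 * α) (hU_load : ∀ x, load U x ≤ 1)
    (hB_load : ∀ x ∈ B, load (fun x k => QR x k + U x k) x ≤ α) :
    ∃ R : W → K → ℝ, (∀ x ∉ B, ∀ k, R x k = 0) ∧ (∀ x, load R x ≤ α * (1 + 6 * τ)) ∧
      (∀ k, ∑ x, (QL x k + QR x k - R x k) = 0) ∧
      ∀ A, φ * dem (fun x k => QL x k + QR x k - R x k) A
        ≤ (9 + 12 * φ) * (α / τ) * cutCap c A := by
  have hα0 : 0 < α := by linarith
  have hμ_pos : ∀ x, 0 < μ x := fun x => by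
    by_cases hx : x ∈ B
    · rwa [hμB x hx]
    · rw [hμ x hx]; exact one_pos
  have hμ_le : ∀ x, τ ≤ μ x := fun x => by
    by_cases hx : x ∈ B
    · rw [hμB x hx]
    · rwa [hμ x hx]
  -- The change from `QL` to `U`, with load at most `2 * α + 1 ≤ 3 * α`.
  set N : W → K → ℝ := fun x k => QL x k - U x k with hN
  have hN_load : ∀ x, load N x ≤ 3 * α := fun x =>
    (load_sub_le QL U x).trans (by linarith [hQL_load x, hU_load x])
  set N₁ : W → K → ℝ := fun x k => if x ∈ Y then N x k else 0 with hN₁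
  set N₂ : W → K → ℝ := fun x k => if x ∉ Y then N x k else 0 with hN₂
  have hN₁₂ : ∀ x k, N₁ x k + N₂ x k = N x k := fun x k => by
    by_cases hx : x ∈ Y <;> simp [hN₁, hN₂, hx]
  -- Vertices of `Y ∩ B` send out only `τ` units, so a load of `3 * α` needs the factor `3 * α / τ`.
  obtain ⟨N', hN'F, hN'load, hN'sum, hN'dem⟩ := hYF.exists_transport (fun s _ => hμ_pos s)
    (l := 3 * α / τ) (by positivity) zero_le_two N₁ (fun x hx k => by simp [hN₁, hx]) (by
      intro s _
      refine ((load_ite_le (· ∈ Y) N s).trans (hN_load s)).trans ?_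
      rw [div_mul_eq_mul_div, le_div_iff₀ hτ0]
      exact mul_le_mul_of_nonneg_left (hμ_le s) (by positivity))
  -- Only what lies off `B` is moved. There `μ` is 1, so the next transport needs no division by
  -- `τ`, and its sinks get load at most `3 * α * (2 * τ)`.
  set M : W → K → ℝ := fun x k => if x ∉ B then QR x k + U x k else 0 with hM
  set M₁ : W → K → ℝ := fun x k => if x ∈ B then QR x k + U x k else 0 with hM₁
  have hM₁₂ : ∀ x k, M₁ x k + M x k = QR x k + U x k := fun x k => by
    by_cases hx : x ∈ B <;> simp [hM₁, hM, hx]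
  obtain ⟨M', hM'B, hM'load, hM'sum, hM'dem⟩ := hYB.exists_transport (fun s _ => hμ_pos s)
    (l := 3 * α) (by positivity) (by positivity) M (fun x hx k => by
      by_cases hxB : x ∈ B
      · simp [hM, hxB]
      · simp [hM, hxB, hQR x hx hxB k, hU x hx k]) (by
      intro s _
      by_cases hs : s ∈ B
      · rw [load_eq_zero (fun k => by simp [hM, hs])]
        exact mul_nonneg (by positivity) (hμ_pos s).le
      · rw [hμ s hs]
        refine (load_ite_le (· ∉ B) (fun x k => QR x k + U x k) s).trans ?_
        exact (load_add_le QR U s).trans (by linarith [hQR_load s, hU_load s]))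
  -- The total change is the transport from `Y` to `F`, a valid state on `F`, and the transport from
  -- `Y` to `B`.
  have hdecomp : ∀ x k, QL x k + QR x k - (M₁ x k + M' x k)
      = ((N₁ x k - N' x k) + (N' x k + N₂ x k)) + (M x k - M' x k) := fun x k => by
    have h1 := hN₁₂ x k
    have h2 := hM₁₂ x k
    simp only [hN] at h1
    linarith
  have hvalid : IsValid fun x k => N' x k + N₂ x k := fun k => by
    rw [Finset.sum_add_distrib, hN'sum, ← Finset.sum_add_distrib,
      Finset.sum_congr rfl fun x _ => hN₁₂ x k, hN, Finset.sum_sub_distrib, hsum, sub_self]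
  refine ⟨fun x k => M₁ x k + M' x k, ?_, ?_, ?_, ?_⟩
  · intro x hx k
    simp [hM₁, hx, hM'B x hx k]
  · intro x
    have h1 : load M₁ x ≤ α := by
      by_cases hx : x ∈ B
      · exact (load_ite_le (· ∈ B) (fun x k => QR x k + U x k) x).trans (hB_load x hx)
      · rw [load_eq_zero fun k => by simp [hM₁, hx]]
        exact hα0.le
    refine (load_add_le M₁ M' x).trans ((add_le_add h1 (hM'load x)).trans_eq ?_)
    ring
  · intro k
    have h := hvalid k
    rw [Finset.sum_congr rfl fun x _ => hdecomp x k, Finset.sum_add_distrib,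
      Finset.sum_add_distrib, h, Finset.sum_sub_distrib, Finset.sum_sub_distrib, hN'sum, hM'sum]
    simp
  · intro A
    have hcut := cutCap_nonneg hc0 A
    have h1 := hN'dem A
    -- The load is at most `2 * (3 * α / τ)` from the transport plus `3 * α` already off `Y`.
    have h2 := hF.mul_dem_le hφ (N := fun x k => N' x k + N₂ x k) (l := 9 * (α / τ))
      (by
        intro x hx k
        by_cases hxY : x ∈ Y
        · simp [hN₂, hxY, hN'F x hx k]
        · simp [hN₂, hxY, hN'F x hx k, hN, hQL x hxY hx k, hU x hxY k]) hvalid (by positivity)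
      (by
        intro x
        refine (load_add_le N' N₂ x).trans ?_
        have h3 : load N₂ x ≤ 3 * α := (load_ite_le (· ∉ Y) N x).trans (hN_load x)
        have h4 : α ≤ α / τ := le_div_self hα0.le hτ0 hτ1
        have h5 := hN'load x
        have h6 : 3 * α / τ = 3 * (α / τ) := by ring
        rw [h6] at h5
        linarith) A
    have h3 := hM'dem A
    have h4 : α ≤ α / τ := le_div_self hα0.le hτ0 hτ1
    have h5 : dem (fun x k => QL x k + QR x k - (M₁ x k + M' x k)) A
        ≤ dem (fun x k => N₁ x k - N' x k) A + dem (fun x k => N' x k + N₂ x k) A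
          + dem (fun x k => M x k - M' x k) A := by
      simp only [hdecomp]
      refine (dem_add_le (fun x k => (N₁ x k - N' x k) + (N' x k + N₂ x k)) _ A).trans ?_
      gcongr
      exact dem_add_le (fun x k => N₁ x k - N' x k) _ A
    have h6 := mul_le_mul_of_nonneg_left (h5.trans (add_le_add (add_le_add_left h1 _) h3)) hφ
    have h7 := mul_le_mul_of_nonneg_right h4 (mul_nonneg hφ hcut)
    -- In units of `α / τ`, the two transports contribute `6 * φ` each, the second because `6 * α ≤
    -- 6 * (α / τ)`, and the state on `F` contributes 9.
    calc _ ≤ _ := h6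
      _ ≤ _ := by
        have e1 : 3 * α / τ * 2 * cutCap c A = 6 * (α / τ) * cutCap c A := by ring
        rw [e1]
        linarith

/-- The demand of a cluster can be spread evenly over its boundary. -/
theorem IsHierarchy.exists_spread {V K : Type*} [Fintype V] [Fintype K] {T : Finset (Finset V)}
    (hT : IsHierarchy T) {G : SimpleGraph V} {P : V → K → ℝ}
    (hP : Respects (treeCap G T) 1 (toTree T P)) {L : Finset V} (hL : L.Nonempty → L ∈ T) :
    ∃ U : SubdivVertex G → K → ℝ, (∀ x ∉ splitSet G (boundaryEdges G L), ∀ k, U x k = 0) ∧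
      (∀ k, ∑ x, U x k = ∑ v ∈ L, P v k) ∧ ∀ x, load U x ≤ 1 := by
  have hcap : 0 ≤ cutCap (unitCap G) L := cutCap_nonneg (unitCap_nonneg G) L
  have hle : ∑ k, |∑ v ∈ L, P v k| ≤ cutCap (unitCap G) L := by
    rcases L.eq_empty_or_nonempty with rfl | hne
    · simpa using hcap
    · exact hT.sum_abs_le_cutCap hP (hL hne)
  refine ⟨fun x k => if x ∈ splitSet G (boundaryEdges G L) then
    (∑ v ∈ L, P v k) / cutCap (unitCap G) L else 0, ?_, ?_, ?_⟩
  · intro x hx k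
    simp [hx]
  · intro k
    have h1 : ∀ x, (if x ∈ splitSet G (boundaryEdges G L) then
        (∑ v ∈ L, P v k) / cutCap (unitCap G) L else 0) = (∑ v ∈ L, P v k) / cutCap (unitCap G) L *
        if x ∈ splitSet G (boundaryEdges G L) then 1 else 0 := fun x => by split_ifs <;> simp
    rw [Finset.sum_congr rfl fun x _ => h1 x, ← Finset.mul_sum, sum_splitSet_boundaryEdges]
    -- With no boundary, `hle` forces the demand of `L` to vanish in every commodity, so the
    -- quotient by 0 is harmless.
    by_cases h0 : cutCap (unitCap G) L = 0
    · rw [h0] at hle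
      have h2 := (Finset.single_le_sum (f := fun k => |∑ v ∈ L, P v k|)
        (fun _ _ => abs_nonneg _) (Finset.mem_univ k)).trans hle
      rw [abs_nonpos_iff.1 h2]
      simp
    · rw [div_mul_cancel₀ _ h0]
  · intro x
    refine (load_ite_le (· ∈ splitSet G (boundaryEdges G L))
      (fun _ k => (∑ v ∈ L, P v k) / cutCap (unitCap G) L) x).trans ?_
    unfold load
    simp only [abs_div, abs_of_nonneg hcap]
    rw [← Finset.sum_div]
    exact div_le_one_of_le₀ hle hcap

theorem endpointCount_core_add_outerPart {V : Type*} (G : SimpleGraph V) (S : Finset V)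
    (Y : Set (Sym2 V)) (x : SubdivVertex G) :
    endpointCount G (core G S Y) x + endpointCount G (outerPart G S Y) x = endpointCount G S x :=
  Finset.sum_sdiff outerPart_subset

/-- One merge step, with the cost of the cuts expressed by the expansion `φ`. -/
theorem exists_merge {V K : Type*} [Fintype V] [Fintype K] {G : SimpleGraph V}
    {T : Finset (Finset V)} (hT : IsHierarchy T) {P : V → K → ℝ}
    (hP : Respects (treeCap G T) 1 (toTree T P)) {τ : ℝ} (hτ0 : 0 < τ) (hτ1 : τ ≤ 1)
    {S : Finset V} {Z : Finpartition S} {φ : ℝ} (hφ : 0 ≤ φ)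
    (hexp : Expands (subCap G (primed G S)) φ
      {x | (x : SubdivVertex G) ∈ splitSet G (interClusterEdges G Z)})
    {Y : Set (Sym2 V)} (hY : IsBottleneckCut G τ Z Y)
    (hcore : (core G S Y).Nonempty → core G S Y ∈ T) {α : ℝ} (hα : 1 ≤ α)
    {Q : Finset V → SubdivVertex G → K → ℝ}
    (hQ : ∀ C ∈ subClusters G Z Y, SatisfiesInvariant G P C α (Q C)) :
    ∃ Pafter : SubdivVertex G → K → ℝ,
      SatisfiesInvariant G P S (α * (1 + 6 * τ)) Pafter ∧
      IsValid (fun (x : primed G S) k => (∑ C ∈ subClusters G Z Y, Q C x k) - Pafter x k) ∧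
      ∀ A, φ * dem
          (fun (x : primed G S) k => (∑ C ∈ subClusters G Z Y, Q C x k) - Pafter x k) A
        ≤ (9 + 12 * φ) * (α / τ) * cutCap (subCap G (primed G S)) A := by
  have hα0 : 0 ≤ α := by linarith
  set L := core G S Y
  set R := outerPart G S Y
  have hQL : ∀ C ∈ pieces Z L, SatisfiesInvariant G P C α (Q C) := fun C hC =>
    hQ C (by rw [subClusters_eq]; exact Finset.mem_union_left _ hC)
  have hQR : ∀ C ∈ pieces Z R, SatisfiesInvariant G P C α (Q C) := fun C hC =>
    hQ C (by rw [subClusters_eq]; exact Finset.mem_union_right _ hC)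
  have hsplit : ∀ (x : SubdivVertex G) k, ∑ C ∈ subClusters G Z Y, Q C x k
      = ∑ C ∈ pieces Z L, Q C x k + ∑ C ∈ pieces Z R, Q C x k := fun x k => by
    rw [subClusters_eq, Finset.sum_union (disjoint_pieces G Z Y)]
  have hLload := load_sum_pieces_le core_subset hα0 hQL
  have hRload := load_sum_pieces_le outerPart_subset hα0 hQR
  obtain ⟨U, hU0, hUsum, hUload⟩ := hT.exists_spread hP (G := G) hcore
  have hLsupp : ∀ x, x ∉ splitSet G Y → x ∉ splitSet G (interClusterEdges G Z) →
      ∀ k, ∑ C ∈ pieces Z L, Q C x k = 0 := fun x hxY hxF k =>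
    sum_pieces_eq_zero hQL (fun C hC ⟨e, he, hx⟩ =>
      (boundaryEdges_pieces_core_subset hC he).elim (fun h => hxY ⟨e, h, hx⟩)
        fun h => hxF ⟨e, h, hx⟩) k
  have hRsupp : ∀ x, x ∉ splitSet G Y → x ∉ splitSet G (boundaryEdges G S) →
      ∀ k, ∑ C ∈ pieces Z R, Q C x k = 0 := fun x hxY hxB k =>
    sum_pieces_eq_zero hQR (fun C hC ⟨e, he, hx⟩ =>
      (hY.boundaryEdges_pieces_outerPart_subset hC he).elim (fun h => hxY ⟨e, h, hx⟩)
        fun h => hxB ⟨e, h, hx⟩) k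
  have hsumW : ∀ (g : SubdivVertex G → ℝ) (D : Finset V), D ⊆ S →
      (∀ x ∉ splitSet G (boundaryEdges G D), g x = 0) → ∑ x : primed G S, g x = ∑ x, g x :=
    fun g D hD hg => sum_subtype_of_support _ _ fun x hx =>
      hg x fun h => hx (splitSet_boundaryEdges_subset_primed hD h)
  have hsumP : ∀ D ⊆ S, (∀ C ∈ pieces Z D, SatisfiesInvariant G P C α (Q C)) → ∀ k,
      ∑ x : primed G S, ∑ C ∈ pieces Z D, Q C x k = ∑ v ∈ D, P v k := fun D hD hD' k => by
    rw [← sum_sum_pieces hD hD' k]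
    refine sum_subtype_of_support _ (fun x => ∑ C ∈ pieces Z D, Q C x k) fun x hx => ?_
    exact sum_pieces_eq_zero hD' (fun C hC h => hx (splitSet_boundaryEdges_subset_primed
      ((subset_of_mem_pieces hC).trans hD) h)) k
  have hload2 : ∀ (D : Finset V) (x : SubdivVertex G), α * endpointCount G D x ≤ 2 * α :=
    fun D x => by
      rw [mul_comm 2]
      exact mul_le_mul_of_nonneg_left (endpointCount_le_two D x) hα0
  obtain ⟨A, hA0, hAload, hAsum, hAdem⟩ := exists_reroute
    (c := subCap G (primed G S)) (fun _ _ => unitCap_nonneg _ _ _)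
    (Y := {x | (x : SubdivVertex G) ∈ splitSet G Y})
    (B := {x | (x : SubdivVertex G) ∈ splitSet G (boundaryEdges G S)})
    hτ0 hτ1 hφ hα (μ := fun x => weight G τ S x)
    (fun x hx => if_pos hx) (fun x hx => if_neg hx)
    hY.flow_boundary hY.flow_interCluster hexp
    (QL := fun x k => ∑ C ∈ pieces Z L, Q C x k) (QR := fun x k => ∑ C ∈ pieces Z R, Q C x k)
    (U := fun x k => U x k)
    (fun x hxY hxF k => hLsupp x hxY hxF k) (fun x hxY hxB k => hRsupp x hxY hxB k)
    (fun x hx k => hU0 x (fun h => hx (splitSet_mono (fun _ => boundaryEdges_core_subset) h)) k)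
    (fun k => by
      rw [hsumP L core_subset hQL, hsumW (fun x => U x k) L core_subset fun x hx => hU0 x hx k,
        hUsum])
    (fun x => (hLload x).trans (hload2 _ _)) (fun x => (hRload x).trans (hload2 _ _))
    (fun x => hUload x)
    -- Both loads are charged to endpoints, and the endpoint counts of the core and of R add up to
    -- that of `S`, which is at most 1 on `B`.
    (fun x hx => by
      have h1 := load_add_le (fun x k => ∑ C ∈ pieces Z R, Q C x k) U (x : SubdivVertex G)
      have h2 : load U (x : SubdivVertex G) ≤ α * endpointCount G L x := by
        by_cases hxL : (x : SubdivVertex G) ∈ splitSet G (boundaryEdges G L)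
        · exact (hUload x).trans (one_le_mul_of_one_le_of_one_le hα
            (one_le_endpointCount_of_boundary hxL))
        · rw [load_eq_zero (hU0 x hxL)]
          exact mul_nonneg hα0 (endpointCount_nonneg _ _)
      have h3 := endpointCount_core_add_outerPart G S Y (x : SubdivVertex G)
      have h4 := mul_le_mul_of_nonneg_left (endpointCount_le_one hx) hα0
      rw [← h3, mul_one, mul_add] at h4
      exact h1.trans (by linarith [hRload x]))
  refine ⟨fun x k => if h : x ∈ primed G S then A ⟨x, h⟩ k else 0, ⟨?_, ?_, ?_⟩, ?_, ?_⟩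
  · intro x hx k
    split_ifs with h
    · exact hA0 ⟨x, h⟩ hx k
    · rfl
  · intro k
    have h1 := hAsum k
    simp only [Finset.sum_sub_distrib, Finset.sum_add_distrib] at h1
    rw [hsumP L core_subset hQL, hsumP R outerPart_subset hQR] at h1
    have h2 : ∑ v ∈ L, P v k + ∑ v ∈ R, P v k = ∑ v ∈ S, P v k :=
      Finset.sum_sdiff outerPart_subset
    simp only [Subtype.coe_prop, dif_pos, Subtype.coe_eta]
    linarith
  · intro x hx
    refine le_trans (le_of_eq ?_) (hAload ⟨x, hx⟩)
    simp [load, hx]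
  · intro k
    simp only [Subtype.coe_prop, dif_pos, Subtype.coe_eta, hsplit]
    exact hAsum k
  · intro X
    simp only [Subtype.coe_prop, dif_pos, Subtype.coe_eta, hsplit]
    exact hAdem X

end MergePhase

/-! ### The choice of the constants -/

theorem mainTheorem6 :
    -- `c` is absolute
    ∃ c : ℝ, 0 < c ∧
    -- `c₀` is the constant of the `Ω(1 / log n)`-expansion of the inter-cluster edges
    ∀ c₀ : ℝ, 0 < c₀ → ∃ c' : ℝ, 0 < c' ∧
    ∀ (V K : Type*) [Fintype V] [Fintype K] (G : SimpleGraph V)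
      -- the hierarchical decomposition tree and a valid demand state that it `1`-respects
      (T : Finset (Finset V)) (_ : MergePhase.IsHierarchy T)
      (P : V → K → ℝ) (_ : MergePhase.IsValid P)
      (_ : MergePhase.Respects (MergePhase.treeCap G T) 1 (MergePhase.toTree T P))
      -- a cluster of the tree, partitioned by the merge phase with parameter `τ`
      (τ : ℝ) (_ : 0 < τ) (_ : τ ≤ 1)
      (S : Finset V) (_ : S ∈ T)
      (Z : Finpartition S) (_ : MergePhase.IsFirstPartition G c₀ Z)
      (Y : Set (Sym2 V)) (_ : MergePhase.IsBottleneckCut G τ Z Y)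
      (_ : (MergePhase.core G S Y).Nonempty → MergePhase.core G S Y ∈ T)
      (_ : (MergePhase.outerPart G S Y).Nonempty → MergePhase.outerPart G S Y ∈ T)
      (_ : MergePhase.subClusters G Z Y ⊆ T)
      -- demand states on the sub-clusters
      (α : ℝ) (_ : 1 ≤ α)
      (Q : Finset V → MergePhase.SubdivVertex G → K → ℝ)
      (_ : ∀ C ∈ MergePhase.subClusters G Z Y, MergePhase.SatisfiesInvariant G P C α (Q C)),
      ∃ Pafter : MergePhase.SubdivVertex G → K → ℝ,
        MergePhase.SatisfiesInvariant G P S (α * (1 + c * τ)) Pafter ∧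
        MergePhase.IsValid (fun (x : MergePhase.primed G S) k =>
          (∑ C ∈ MergePhase.subClusters G Z Y, Q C x k) - Pafter x k) ∧
        MergePhase.Respects (MergePhase.subCap G (MergePhase.primed G S))
          (c' * τ / (α * Real.logb 2 (Fintype.card V)))
          (fun (x : MergePhase.primed G S) k =>
            (∑ C ∈ MergePhase.subClusters G Z Y, Q C x k) - Pafter x k) := by
  -- The denominator is the cost factor `9 + 12 * φ` at the largest value of `φ = c₀ / lg`, which is
  -- at most `c₀` once `1 ≤ lg`.
  refine ⟨6, by norm_num, fun c₀ hc₀ => ⟨c₀ / (9 + 12 * c₀), by positivity, ?_⟩⟩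
  intro V K _ _ G T hT P _ hP τ hτ0 hτ1 S _ Z hZ Y hY hcore _ _ α hα Q hQ
  set lg := Real.logb 2 (Fintype.card V) with hlg
  -- For fewer than two vertices the logarithm is 0, and so is the quotient in the conclusion; the
  -- bound is then trivial.
  have hlog : lg = 0 ∨ 1 ≤ lg := by
    rcases lt_or_ge (Fintype.card V) 2 with h | h
    · left
      interval_cases Fintype.card V <;> simp [hlg]
    · right
      rw [hlg, Real.le_logb_iff_rpow_le one_lt_two (by positivity)]
      simpa using (by exact_mod_cast h : (2 : ℝ) ≤ Fintype.card V)
  have hlg0 : 0 ≤ lg := by rcases hlog with h | h <;> linarith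
  obtain ⟨R, hR1, hR2, hR3⟩ := MergePhase.exists_merge hT hP hτ0 hτ1
    (div_nonneg hc₀.le hlg0) hZ.expands_primed hY hcore hα hQ
  refine ⟨R, hR1, hR2, fun A => ?_⟩
  have hcut : 0 ≤ MergePhase.cutCap (MergePhase.subCap G (MergePhase.primed G S)) A :=
    MergePhase.cutCap_nonneg (fun _ _ => MergePhase.unitCap_nonneg _ _ _) A
  rcases hlog with h0 | h1
  · rw [h0]
    simpa using hcut
  · have hA := hR3 A
    have hα0 : 0 < α := by linarith
    have hφ : c₀ / lg ≤ c₀ := div_le_self hc₀.le h1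
    have e1 : ∀ d : ℝ, c₀ / (9 + 12 * c₀) * τ / (α * lg) * d
        = (τ / (α * (9 + 12 * c₀))) * (c₀ / lg * d) := fun d => by
      field_simp
    calc _ = _ := e1 _
      _ ≤ (τ / (α * (9 + 12 * c₀))) * ((9 + 12 * c₀) * (α / τ) *
          MergePhase.cutCap (MergePhase.subCap G (MergePhase.primed G S)) A) := by
        refine mul_le_mul_of_nonneg_left (hA.trans ?_) (by positivity)
        gcongr
      _ = _ := by
        field_simp
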